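/- For a positive integer $h$ and a finite set $A=\{a_1,\dots,a_k\}$ of $k$ distinct integers, let $$h^{\wedge}_{\pm}A=\Bigl\{\sum_{i=1}^{k}\lambda_i a_i:\ \lambda_i\in\{-1,0,1\}\text{ for } i=1,\dots,k,\ \sum_{i=1}^{k}|\lambda_i|=h\Bigr\},$$ and for an integer $c$ let $c\ast A=\{ca: a\in A\}$. Theorem. Let $A$ be a set of $k\ge 5$ positive integers. Then $$\left|4^{\wedge}_{\pm}A\right|\ge 8k-15.$$ Furthermore, if $\left|4^{\wedge}_{\pm}A\right|=8k-15$, then $A=\min(A)\ast\{1,3,\dots,2k-1\}$. -/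

import Mathlib

/-- The restricted `h`-fold signed sumset of a finite set `A` of integers: all sums
`∑ a ∈ A, l a * a` with coefficients `l a ∈ {-1, 0, 1}` such that `∑ a ∈ A, |l a| = h`. -/
def restrictedSignedSumset (h : ℕ) (A : Finset ℤ) : Set ℤ :=
  {x | ∃ l : ℤ → ℤ, (∀ a ∈ A, l a ∈ Set.Icc (-1 : ℤ) 1) ∧
    ∑ a ∈ A, |l a| = (h : ℤ) ∧ x = ∑ a ∈ A, l a * a}

/-- The dilate `c ∗ A = {c * a : a ∈ A}`. -/
def dilate (c : ℤ) (A : Finset ℤ) : Finset ℤ :=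
  A.image (fun a => c * a)

/-- The set `{1, 3, …, 2k - 1}` of the first `k` odd positive integers. -/
def firstOdds (k : ℕ) : Finset ℤ :=
  (Finset.range k).image (fun i : ℕ => 2 * (i : ℤ) + 1)

/-! The proof is an induction on `k` that removes the largest element `M`. The sumset is symmetric
about 0, so increasing chains of positive sums do the counting. If `w < x < y < z` are the largest
of the remaining elements, every old sum has absolute value at most `w + x + y + z`. Adding `M` to
three of these four gives four larger sums, so with negatives the sumset gains at least 8 elements
(`insert_step`). For `k = 5`, `five_dichotomy` finds 13 positive sums unless the set is `a * {1, 3,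
5, 7, 9}`, where 0 and 12 positive sums give 25. Equality for `k + 1` forces equality for `k`, so
the smaller set is a dilate of the odd numbers. One further sum, just below the four new ones, must
then be old, and size and divisibility determine `M` (`eq_of_ncard_insert_dilate`). -/

/-! ### Symmetric counting and monotonicity -/

/-- Adding to a bounded subset of a symmetric set a chain of elements above the bound, together
with their negatives. -/
theorem ncard_add_two_mul_length_le {S T : Set ℤ} (hS : S.Finite) (hneg : ∀ x ∈ S, -x ∈ S)
    (hTS : T ⊆ S) {U : ℤ} (hU : 0 ≤ U) (hT : ∀ x ∈ T, |x| ≤ U) (l : List ℤ) (hlS : ∀ x ∈ l, x ∈ S)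
    (hl : (U :: l).IsChain (· < ·)) : T.ncard + 2 * l.length ≤ S.ncard := by
  have hp := List.isChain_iff_pairwise.mp hl
  rw [List.pairwise_cons] at hp
  obtain ⟨hUl, hp⟩ := hp
  have hnd : l.Nodup := hp.imp (fun h => ne_of_lt h)
  set P : Finset ℤ := l.toFinset with hP
  have hPc : P.card = l.length := List.toFinset_card_of_nodup hnd
  have hTf : T.Finite := hS.subset hTS
  set N : Finset ℤ := P.image (fun x => -x) with hN
  have hNc : N.card = l.length := by
    rw [hN, Finset.card_image_of_injective _ neg_injective, hPc]
  have hmem : ∀ x ∈ P, x ∈ S ∧ U < x := fun x hx =>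
    ⟨hlS x (List.mem_toFinset.mp hx), hUl x (List.mem_toFinset.mp hx)⟩
  have hmemN : ∀ x ∈ N, x ∈ S ∧ x < -U := by
    intro x hx
    obtain ⟨y, hy, rfl⟩ := Finset.mem_image.mp hx
    exact ⟨hneg y (hmem y hy).1, neg_lt_neg (hmem y hy).2⟩
  have hPN : Disjoint P N := Finset.disjoint_left.mpr fun x hx hx' => by
    have := (hmem x hx).2
    have := (hmemN x hx').2
    omega
  have hTPN : Disjoint hTf.toFinset (P ∪ N) := Finset.disjoint_left.mpr fun x hx hx' => by
    have h := abs_le.mp (hT x (hTf.mem_toFinset.mp hx))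
    rcases Finset.mem_union.mp hx' with hx' | hx'
    · have := (hmem x hx').2
      omega
    · have := (hmemN x hx').2
      omega
  have hsub : hTf.toFinset ∪ (P ∪ N) ⊆ hS.toFinset := by
    intro x hx
    rw [hS.mem_toFinset]
    rcases Finset.mem_union.mp hx with hx | hx
    · exact hTS (hTf.mem_toFinset.mp hx)
    · rcases Finset.mem_union.mp hx with hx | hx
      · exact (hmem x hx).1
      · exact (hmemN x hx).1
  have hc := Finset.card_le_card hsub
  rw [Finset.card_union_of_disjoint hTPN, Finset.card_union_of_disjoint hPN, hPc, hNc,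
    ← Set.ncard_eq_toFinset_card T hTf, ← Set.ncard_eq_toFinset_card S hS] at hc
  omega

theorem neg_mem_restrictedSignedSumset {h : ℕ} {A : Finset ℤ} {x : ℤ}
    (hx : x ∈ restrictedSignedSumset h A) : -x ∈ restrictedSignedSumset h A := by
  obtain ⟨l, h1, h2, rfl⟩ := hx
  refine ⟨fun a => -l a, fun a ha => ?_, by simpa using h2, by simp⟩
  have := h1 a ha
  simp only [Set.mem_Icc] at this ⊢
  omega

theorem restrictedSignedSumset_mono {h : ℕ} {A B : Finset ℤ} (hAB : A ⊆ B) :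
    restrictedSignedSumset h A ⊆ restrictedSignedSumset h B := by
  rintro x ⟨l, h1, h2, rfl⟩
  have key : ∀ f : ℤ → ℤ, (∀ a ∉ A, f a = 0) → ∑ a ∈ B, f a = ∑ a ∈ A, f a := fun f hf =>
    (Finset.sum_subset hAB fun a _ ha => hf a ha).symm
  refine ⟨fun a => if a ∈ A then l a else 0, fun a _ => ?_, ?_, ?_⟩
  · by_cases ha : a ∈ A
    · simpa [ha] using h1 a ha
    · simp [ha]
  · rw [key _ (by simp +contextual), ← h2]
    exact Finset.sum_congr rfl fun a ha => by simp [ha]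
  · rw [key _ (by simp +contextual)]
    exact Finset.sum_congr rfl fun a ha => by simp [ha]

/-! ### Sums on five elements -/

/-- The linear form in `a, b, c, d, e` with coefficient vector `v`. -/
def signedSum (a b c d e : ℤ) (v : ℤ × ℤ × ℤ × ℤ × ℤ) : ℤ :=
  v.1 * a + v.2.1 * b + v.2.2.1 * c + v.2.2.2.1 * d + v.2.2.2.2 * e

/-- Coefficient vectors with entries in `{-1, 0, 1}` and exactly four nonzero entries. -/
def IsSignVector (v : ℤ × ℤ × ℤ × ℤ × ℤ) : Prop :=
  |v.1| ≤ 1 ∧ |v.2.1| ≤ 1 ∧ |v.2.2.1| ≤ 1 ∧ |v.2.2.2.1| ≤ 1 ∧ |v.2.2.2.2| ≤ 1 ∧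
    |v.1| + |v.2.1| + |v.2.2.1| + |v.2.2.2.1| + |v.2.2.2.2| = 4

instance : DecidablePred IsSignVector := fun v => by unfold IsSignVector; infer_instance

theorem signedSum_mem {A : Finset ℤ} {a b c d e : ℤ} (hab : a < b) (hbc : b < c) (hcd : c < d)
    (hde : d < e) (hA : {a, b, c, d, e} ⊆ A) {v : ℤ × ℤ × ℤ × ℤ × ℤ} (hv : IsSignVector v) :
    signedSum a b c d e v ∈ restrictedSignedSumset 4 A := by
  apply restrictedSignedSumset_mono hA
  obtain ⟨p, q, r, s, t⟩ := v
  obtain ⟨h1, h2, h3, h4, h5, h6⟩ := hv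
  simp only [abs_le] at h1 h2 h3 h4 h5
  have n1 : a ∉ ({b, c, d, e} : Finset ℤ) := by simp; omega
  have n2 : b ∉ ({c, d, e} : Finset ℤ) := by simp; omega
  have n3 : c ∉ ({d, e} : Finset ℤ) := by simp; omega
  have n4 : d ∉ ({e} : Finset ℤ) := by simp; omega
  have hb : b ≠ a := by omega
  have hc : c ≠ a ∧ c ≠ b := by omega
  have hd : d ≠ a ∧ d ≠ b ∧ d ≠ c := by omega
  have he : e ≠ a ∧ e ≠ b ∧ e ≠ c ∧ e ≠ d := by omega
  refine ⟨fun x => if x = a then p else if x = b then q else if x = c then r else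
    if x = d then s else t, fun x _ => ?_, ?_, ?_⟩
  · simp only [Set.mem_Icc]
    split_ifs <;> assumption
  · rw [Finset.sum_insert n1, Finset.sum_insert n2, Finset.sum_insert n3, Finset.sum_insert n4,
      Finset.sum_singleton]
    simp only [if_true, if_neg hb, if_neg hc.1, if_neg hc.2, if_neg hd.1, if_neg hd.2.1,
      if_neg hd.2.2, if_neg he.1, if_neg he.2.1, if_neg he.2.2.1, if_neg he.2.2.2]
    push_cast
    linarith
  · rw [Finset.sum_insert n1, Finset.sum_insert n2, Finset.sum_insert n3, Finset.sum_insert n4,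
      Finset.sum_singleton]
    simp only [if_true, if_neg hb, if_neg hc.1, if_neg hc.2, if_neg hd.1, if_neg hd.2.1,
      if_neg hd.2.2, if_neg he.1, if_neg he.2.1, if_neg he.2.2.1, if_neg he.2.2.2, signedSum]
    ring

/-! ### Largest elements, odd dilates and bounds -/

theorem exists_eq_insert_of_card {n : ℕ} {A : Finset ℤ} (hA : A.card = n + 1) :
    ∃ m B, A = insert m B ∧ B.card = n ∧ ∀ b ∈ B, b < m := by
  have hne : A.Nonempty := Finset.card_pos.mp (by omega)
  refine ⟨A.max' hne, A.erase (A.max' hne), (Finset.insert_erase (A.max'_mem hne)).symm, ?_,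
    fun b hb => ?_⟩
  · rw [Finset.card_erase_of_mem (A.max'_mem hne), hA]
    omega
  · exact lt_of_le_of_ne (A.le_max' b (Finset.mem_of_mem_erase hb)) (Finset.ne_of_mem_erase hb)

/-- Splitting off the four largest elements. -/
theorem exists_top_four {n : ℕ} {A : Finset ℤ} (hA : A.card = n + 4) :
    ∃ w x y z B, A = insert z (insert y (insert x (insert w B))) ∧ B.card = n ∧
      w < x ∧ x < y ∧ y < z ∧ ∀ b ∈ B, b < w := by
  obtain ⟨z, B₁, rfl, h1, hz⟩ := exists_eq_insert_of_card hA
  obtain ⟨y, B₂, rfl, h2, hy⟩ := exists_eq_insert_of_card h1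
  obtain ⟨x, B₃, rfl, h3, hx⟩ := exists_eq_insert_of_card h2
  obtain ⟨w, B, rfl, h4, hw⟩ := exists_eq_insert_of_card h3
  exact ⟨w, x, y, z, B, rfl, h4, hx w (by simp), hy x (by simp), hz y (by simp), hw⟩

theorem dilate_firstOdds_succ (m : ℤ) (k : ℕ) :
    dilate m (firstOdds (k + 1)) = insert (m * (2 * k + 1)) (dilate m (firstOdds k)) := by
  simp [dilate, firstOdds, Finset.range_add_one]

theorem mul_mem_dilate_firstOdds (m : ℤ) {i k : ℕ} (hi : i < k) :
    m * (2 * i + 1) ∈ dilate m (firstOdds k) :=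
  Finset.mem_image_of_mem _ (Finset.mem_image_of_mem _ (Finset.mem_range.mpr hi))

/-- The weights `|l a|` lie in `[0, 1]` and total 4. Measuring each element from `w` turns the total
into `4 * w` plus weighted differences `a - w`, which are negative on `B` and at most `a - w` on
`x`, `y`, `z`. -/
theorem abs_le_of_mem_restrictedSignedSumset {A B : Finset ℤ} {w x y z : ℤ}
    (hA : A = insert z (insert y (insert x (insert w B)))) (hwx : w < x) (hxy : x < y)
    (hyz : y < z) (hB : ∀ b ∈ B, b < w) (hpos : ∀ a ∈ A, 0 < a) {t : ℤ}
    (ht : t ∈ restrictedSignedSumset 4 A) : |t| ≤ w + x + y + z := by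
  obtain ⟨l, h1, h2, rfl⟩ := ht
  have hl : ∀ a ∈ A, 0 ≤ |l a| ∧ |l a| ≤ 1 := fun a ha =>
    ⟨abs_nonneg _, abs_le.mpr (h1 a ha)⟩
  have hw : w ∉ B := fun h => lt_irrefl _ (hB w h)
  have hx : x ∉ insert w B := by
    rw [Finset.mem_insert, not_or]
    exact ⟨hwx.ne', fun h => by have := hB x h; omega⟩
  have hy : y ∉ insert x (insert w B) := by
    simp only [Finset.mem_insert, not_or]
    exact ⟨by omega, by omega, fun h => by have := hB y h; omega⟩
  have hz : z ∉ insert y (insert x (insert w B)) := by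
    simp only [Finset.mem_insert, not_or]
    exact ⟨by omega, by omega, by omega, fun h => by have := hB z h; omega⟩
  have step : |∑ a ∈ A, l a * a| ≤ ∑ a ∈ A, |l a| * (a - w) + 4 * w := by
    calc |∑ a ∈ A, l a * a| ≤ ∑ a ∈ A, |l a * a| := Finset.abs_sum_le_sum_abs _ _
      _ = ∑ a ∈ A, (|l a| * (a - w) + |l a| * w) := Finset.sum_congr rfl fun a ha => by
          rw [abs_mul, abs_of_pos (hpos a ha)]
          ring
      _ = ∑ a ∈ A, |l a| * (a - w) + 4 * w := by
          rw [Finset.sum_add_distrib, ← Finset.sum_mul, h2]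
          norm_num
  have hlow : ∑ a ∈ B, |l a| * (a - w) ≤ 0 := Finset.sum_nonpos fun a ha =>
    mul_nonpos_of_nonneg_of_nonpos (abs_nonneg _) (by have := hB a ha; omega)
  have top : ∀ a ∈ A, w < a → |l a| * (a - w) ≤ a - w := fun a ha hwa =>
    mul_le_of_le_one_left (by omega) (hl a ha).2
  have tx := top x (by simp [hA]) hwx
  have ty := top y (by simp [hA]) (by omega)
  have tz := top z (by simp [hA]) (by omega)
  have hsum : ∑ a ∈ A, |l a| * (a - w) = |l z| * (z - w) + (|l y| * (y - w) +
      (|l x| * (x - w) + (|l w| * (w - w) + ∑ a ∈ B, |l a| * (a - w)))) := by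
    rw [hA, Finset.sum_insert hz, Finset.sum_insert hy, Finset.sum_insert hx, Finset.sum_insert hw]
  rw [sub_self, mul_zero] at hsum
  linarith

theorem finite_restrictedSignedSumset {A : Finset ℤ} (hA : 4 ≤ A.card) (hpos : ∀ a ∈ A, 0 < a) :
    (restrictedSignedSumset 4 A).Finite := by
  obtain ⟨n, hn⟩ := Nat.exists_eq_add_of_le' hA
  obtain ⟨w, x, y, z, B, h, -, h1, h2, h3, h4⟩ := exists_top_four hn
  refine (Set.finite_Icc (-(w + x + y + z)) (w + x + y + z)).subset fun t ht => ?_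
  exact abs_le.mp (abs_le_of_mem_restrictedSignedSumset h h1 h2 h3 h4 hpos ht)

/-- Modulo `2 * m`, each odd multiple of `m` is congruent to `m`, and so is its negative. A sum of
four signed terms is thus congruent to `4 * m`, hence to 0. -/
theorem dvd_of_mem_restrictedSignedSumset_dilate {m t : ℤ} {k : ℕ}
    (ht : t ∈ restrictedSignedSumset 4 (dilate m (firstOdds k))) : 2 * m ∣ t := by
  obtain ⟨l, h1, h2, rfl⟩ := ht
  have h : 2 * m ∣ ∑ a ∈ dilate m (firstOdds k), (l a * a - m * |l a|) := by
    refine Finset.dvd_sum fun a ha => ?_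
    have hl := h1 a ha
    simp only [dilate, firstOdds, Finset.mem_image, Finset.mem_range] at ha
    obtain ⟨_, ⟨i, -, rfl⟩, rfl⟩ := ha
    rw [Set.mem_Icc] at hl
    obtain h0 | h0 | h0 : l (m * (2 * (i : ℤ) + 1)) = -1 ∨ l (m * (2 * (i : ℤ) + 1)) = 0 ∨
      l (m * (2 * (i : ℤ) + 1)) = 1 := by omega
    · exact ⟨-(i + 1), by rw [h0]; norm_num; ring⟩
    · exact ⟨0, by rw [h0]; norm_num⟩
    · exact ⟨i, by rw [h0]; norm_num; ring⟩
  rw [Finset.sum_sub_distrib, ← Finset.mul_sum, h2] at h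
  have h' := dvd_add h (⟨2, by push_cast; ring⟩ : 2 * m ∣ m * ((4 : ℕ) : ℤ))
  simpa using h'

/-- `T` holds the sums already counted: nothing, 0 alone, or an old sumset. New sums enter as
coefficient vectors, so membership is decidable and only the chain inequalities remain. -/
theorem ncard_add_two_mul_length_le_of_subset {A : Finset ℤ} (hA : 4 ≤ A.card)
    (hpos : ∀ a ∈ A, 0 < a) {a b c d e : ℤ} (hab : a < b) (hbc : b < c) (hcd : c < d) (hde : d < e)
    (hsub : {a, b, c, d, e} ⊆ A) {T : Set ℤ} (hT : T ⊆ restrictedSignedSumset 4 A) {U : ℤ}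
    (hU : 0 ≤ U) (hTU : ∀ x ∈ T, |x| ≤ U) (l : List (ℤ × ℤ × ℤ × ℤ × ℤ))
    (hv : ∀ v ∈ l, IsSignVector v) (hl : (U :: l.map (signedSum a b c d e)).IsChain (· < ·)) :
    T.ncard + 2 * l.length ≤ (restrictedSignedSumset 4 A).ncard := by
  have h := ncard_add_two_mul_length_le (finite_restrictedSignedSumset hA hpos)
    (fun _ => neg_mem_restrictedSignedSumset) hT hU hTU (l.map (signedSum a b c d e))
    (fun x hx => by
      obtain ⟨v, hv', rfl⟩ := List.mem_map.mp hx
      exact signedSum_mem hab hbc hcd hde hsub (hv v hv')) hl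
  simpa using h

/-! ### The five-element case -/

/-- Outside the extremal configuration `a * {1, 3, 5, 7, 9}` there are at least thirteen positive
sums. -/
theorem five_dichotomy {A : Finset ℤ} (hA : 4 ≤ A.card) (hpos : ∀ a ∈ A, 0 < a)
    {a b c d e : ℤ} (ha : 0 < a) (hab : a < b) (hbc : b < c) (hcd : c < d) (hde : d < e)
    (hsub : {a, b, c, d, e} ⊆ A) :
    26 ≤ (restrictedSignedSumset 4 A).ncard ∨
      b = 3 * a ∧ c = 5 * a ∧ d = 7 * a ∧ e = 9 * a := by
  -- Every leaf but one of the case tree supplies a list for `H`, increasing by the inequalities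
  -- collected along its branch.
  have H : ∀ l : List (ℤ × ℤ × ℤ × ℤ × ℤ), l.length = 13 → (∀ v ∈ l, IsSignVector v) →
      (0 :: l.map (signedSum a b c d e)).IsChain (· < ·) →
      26 ≤ (restrictedSignedSumset 4 A).ncard ∨
        b = 3 * a ∧ c = 5 * a ∧ d = 7 * a ∧ e = 9 * a := by
    intro l h13 hv hl
    have h := ncard_add_two_mul_length_le_of_subset hA hpos hab hbc hcd hde hsub
      (Set.empty_subset _) le_rfl (by simp) l hv hl
    rw [Set.ncard_empty] at h
    left
    omega
  rcases lt_or_ge (a + c) (2 * b) with h | h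
  · rcases lt_or_ge (2 * a + b) (d) with h | h
    · exact H [(0, -1, 1, -1, 1), (-1, 1, 0, -1, 1), (-1, 0, 1, -1, 1), (1, 0, 1, -1, 1),
        (-1, -1, 1, 0, 1), (-1, -1, 0, 1, 1), (1, -1, 0, 1, 1), (0, 1, -1, 1, 1),
        (0, -1, 1, 1, 1), (-1, 1, 0, 1, 1), (-1, 0, 1, 1, 1), (1, 0, 1, 1, 1),
        (0, 1, 1, 1, 1)]
        rfl (by decide) (by simp [signedSum]; omega)
    · exact H [(-1, 1, 0, -1, 1), (-1, 0, 1, -1, 1), (-1, -1, 1, 0, 1), (-1, -1, 0, 1, 1),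
        (1, -1, 1, 0, 1), (1, -1, 0, 1, 1), (0, 1, -1, 1, 1), (0, -1, 1, 1, 1),
        (-1, 1, 0, 1, 1), (-1, 0, 1, 1, 1), (1, 1, 0, 1, 1), (1, 0, 1, 1, 1),
        (0, 1, 1, 1, 1)]
        rfl (by decide) (by simp [signedSum]; omega)
  · rcases lt_or_ge (2 * a + e) (2 * b + d) with h | h
    · rcases lt_or_ge (2 * a + e) (2 * b + c) with h | h
      · exact H [(-1, 1, -1, 1, 0), (-1, 1, -1, 0, 1), (0, -1, -1, 1, 1),
          (-1, -1, 1, 1, 0), (-1, -1, 1, 0, 1), (-1, -1, 0, 1, 1), (1, -1, 0, 1, 1),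
          (-1, 1, 1, 1, 0), (-1, 1, 1, 0, 1), (-1, 1, 0, 1, 1), (1, 1, 0, 1, 1),
          (1, 0, 1, 1, 1), (0, 1, 1, 1, 1)]
          rfl (by decide) (by simp [signedSum]; omega)
      · rcases lt_or_ge (2 * b) (a + c) with h | h
        · exact H [(1, -1, -1, 0, 1), (-1, 1, -1, 1, 0), (-1, 1, -1, 0, 1),
            (0, -1, -1, 1, 1), (-1, 0, -1, 1, 1), (1, 0, -1, 1, 1), (0, 1, -1, 1, 1),
            (1, -1, 0, 1, 1), (-1, 1, 0, 1, 1), (0, -1, 1, 1, 1), (-1, 0, 1, 1, 1),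
            (1, 0, 1, 1, 1), (0, 1, 1, 1, 1)]
            rfl (by decide) (by simp [signedSum]; omega)
        · rcases lt_or_ge (2 * c) (a + e) with h | h
          · exact H [(-1, 0, 1, 1, -1), (1, 0, 1, 1, -1), (0, 1, 1, 1, -1),
              (1, 1, -1, 1, 0), (1, 1, -1, 0, 1), (1, -1, 1, 1, 0), (1, -1, 1, 0, 1),
              (-1, 1, 1, 1, 0), (0, 1, -1, 1, 1), (-1, 1, 0, 1, 1), (-1, 0, 1, 1, 1),
              (1, 0, 1, 1, 1), (0, 1, 1, 1, 1)]
              rfl (by decide) (by simp [signedSum]; omega)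
          · rcases lt_or_ge (2 * a + 2 * b + 2 * c) (d + e) with h | h
            · exact H [(-1, -1, 1, 1, 0), (1, -1, 1, 1, 0), (-1, 0, -1, 1, 1),
                (1, 0, -1, 1, 1), (-1, -1, 0, 1, 1), (-1, 1, 1, 1, 0), (-1, 1, 1, 0, 1),
                (1, 1, 1, 0, 1), (-1, 1, 0, 1, 1), (1, 1, 0, 1, 1), (-1, 0, 1, 1, 1),
                (1, 0, 1, 1, 1), (0, 1, 1, 1, 1)]
                rfl (by decide) (by simp [signedSum]; omega)
            · rcases lt_or_ge (2 * a + 2 * b + e) (c + 2 * d) with h | h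
              · rcases lt_or_ge (2 * a + 2 * b + e) (2 * c + d) with h | h
                · exact H [(-1, 1, -1, 0, 1), (1, 1, -1, 0, 1), (-1, -1, 1, 1, 0),
                    (-1, -1, 1, 0, 1), (1, -1, 1, 0, 1), (-1, -1, 0, 1, 1),
                    (-1, 1, 1, 1, 0), (-1, 1, 1, 0, 1), (1, 1, 1, 0, 1), (-1, 1, 0, 1, 1),
                    (-1, 0, 1, 1, 1), (1, 0, 1, 1, 1), (0, 1, 1, 1, 1)]
                    rfl (by decide) (by simp [signedSum]; omega)
                · rcases lt_or_ge (d + e) (2 * b + 2 * c) with h | h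
                  · exact H [(1, 1, 0, -1, 1), (-1, -1, 1, 1, 0), (-1, -1, 1, 0, 1),
                      (0, 1, 1, -1, 1), (-1, -1, 0, 1, 1), (1, -1, 1, 0, 1),
                      (-1, 1, 1, 1, 0), (-1, 1, 1, 0, 1), (-1, 1, 0, 1, 1),
                      (1, 1, 1, 0, 1), (1, 1, 0, 1, 1), (1, 0, 1, 1, 1), (0, 1, 1, 1, 1)]
                      rfl (by decide) (by simp [signedSum]; omega)
                  · rcases lt_or_ge (2 * a + 2 * b + c + d) (2 * e) with h | h
                    · exact H [(-1, -1, 1, 1, 0), (1, -1, 1, 1, 0), (-1, 0, -1, 1, 1),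
                        (-1, -1, 1, 0, 1), (-1, -1, 0, 1, 1), (-1, 1, 1, 1, 0),
                        (1, 1, 1, 1, 0), (-1, 1, 1, 0, 1), (-1, 1, 0, 1, 1),
                        (1, 1, 0, 1, 1), (-1, 0, 1, 1, 1), (1, 0, 1, 1, 1),
                        (0, 1, 1, 1, 1)]
                        rfl (by decide) (by simp [signedSum]; omega)
                    · rcases lt_or_ge (2 * a + b + e) (2 * d) with h | h
                      · exact H [(-1, -1, 1, 0, 1), (-1, 0, -1, 1, 1), (1, -1, 1, 1, 0),
                          (-1, -1, 0, 1, 1), (1, 0, -1, 1, 1), (-1, 1, 1, 1, 0),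
                          (-1, 1, 1, 0, 1), (1, 1, 1, 1, 0), (-1, 1, 0, 1, 1),
                          (-1, 0, 1, 1, 1), (1, 1, 0, 1, 1), (1, 0, 1, 1, 1),
                          (0, 1, 1, 1, 1)]
                          rfl (by decide) (by simp [signedSum]; omega)
                      · rcases lt_or_ge (2 * a + b) (c) with h | h
                        · exact H [(1, -1, 1, 1, 0), (-1, 0, -1, 1, 1), (-1, -1, 1, 0, 1),
                            (1, 0, -1, 1, 1), (-1, -1, 0, 1, 1), (-1, 1, 1, 1, 0),
                            (1, 1, 1, 1, 0), (-1, 1, 1, 0, 1), (-1, 1, 0, 1, 1),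
                            (1, 1, 0, 1, 1), (-1, 0, 1, 1, 1), (1, 0, 1, 1, 1),
                            (0, 1, 1, 1, 1)]
                            rfl (by decide) (by simp [signedSum]; omega)
                        -- The branch has forced `2 * b = a + c`. With the other reversed
                        -- inequalities, this leaves only the progression.
                        · right
                          omega
              · exact H [(-1, 1, -1, 1, 0), (-1, 1, -1, 0, 1), (-1, -1, 1, 1, 0),
                  (-1, -1, 1, 0, 1), (-1, -1, 0, 1, 1), (1, -1, 1, 0, 1), (-1, 1, 1, 1, 0),
                  (-1, 1, 1, 0, 1), (-1, 1, 0, 1, 1), (1, 1, 1, 0, 1), (1, 1, 0, 1, 1),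
                  (1, 0, 1, 1, 1), (0, 1, 1, 1, 1)]
                  rfl (by decide) (by simp [signedSum]; omega)
    · rcases lt_or_ge (a + d) (2 * c) with h | h
      · rcases lt_or_ge (2 * a + d) (2 * b + c) with h | h
        · exact H [(1, -1, 0, -1, 1), (1, -1, -1, 0, 1), (-1, 1, 0, -1, 1),
            (-1, 1, -1, 0, 1), (0, -1, -1, 1, 1), (-1, 0, -1, 1, 1), (1, 0, -1, 1, 1),
            (0, 1, -1, 1, 1), (-1, 1, 1, 0, 1), (-1, 1, 0, 1, 1), (1, 1, 0, 1, 1),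
            (1, 0, 1, 1, 1), (0, 1, 1, 1, 1)]
            rfl (by decide) (by simp [signedSum]; omega)
        · exact H [(-1, 1, -1, 1, 0), (0, -1, 1, -1, 1), (-1, 0, 1, -1, 1),
            (1, 0, 1, -1, 1), (0, 1, 1, -1, 1), (1, 0, -1, 1, 1), (0, 1, -1, 1, 1),
            (-1, 1, 1, 0, 1), (-1, 1, 0, 1, 1), (0, -1, 1, 1, 1), (-1, 0, 1, 1, 1),
            (1, 0, 1, 1, 1), (0, 1, 1, 1, 1)]
            rfl (by decide) (by simp [signedSum]; omega)
      · rcases lt_or_ge (2 * a + c) (d) with h | h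
        · exact H [(1, -1, 0, -1, 1), (-1, 1, 0, -1, 1), (-1, 0, 1, -1, 1),
            (1, 0, 1, -1, 1), (0, 1, 1, -1, 1), (-1, -1, 1, 0, 1), (-1, 0, -1, 1, 1),
            (1, 0, -1, 1, 1), (0, 1, -1, 1, 1), (-1, 1, 0, 1, 1), (-1, 0, 1, 1, 1),
            (1, 0, 1, 1, 1), (0, 1, 1, 1, 1)]
            rfl (by decide) (by simp [signedSum]; omega)
        · exact H [(-1, 1, 0, -1, 1), (-1, 0, 1, -1, 1), (-1, 1, -1, 0, 1),
            (-1, -1, 1, 0, 1), (-1, 0, -1, 1, 1), (-1, -1, 0, 1, 1), (1, 0, -1, 1, 1),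
            (0, 1, -1, 1, 1), (-1, 1, 0, 1, 1), (-1, 0, 1, 1, 1), (1, 1, 0, 1, 1),
            (1, 0, 1, 1, 1), (0, 1, 1, 1, 1)]
            rfl (by decide) (by simp [signedSum]; omega)

theorem five_base {A : Finset ℤ} (hA : A.card = 5) (hpos : ∀ a ∈ A, 0 < a) :
    25 ≤ (restrictedSignedSumset 4 A).ncard ∧
      ((restrictedSignedSumset 4 A).ncard = 25 → ∃ m, A = dilate m (firstOdds 5)) := by
  obtain ⟨b, c, d, e, B, rfl, hB, hbc, hcd, hde, hlt⟩ := exists_top_four (n := 1) hA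
  obtain ⟨a, rfl⟩ := Finset.card_eq_one.mp hB
  have hab : a < b := hlt a (by simp)
  have ha : 0 < a := hpos a (by simp)
  have hsub : ({a, b, c, d, e} : Finset ℤ) ⊆ insert e (insert d (insert c (insert b {a}))) := by
    intro x hx
    simp only [Finset.mem_insert, Finset.mem_singleton] at hx ⊢
    tauto
  rcases five_dichotomy (by omega) hpos ha hab hbc hcd hde hsub with h | ⟨rfl, rfl, rfl, rfl⟩
  · exact ⟨by omega, fun h' => by omega⟩
  · refine ⟨?_, fun _ => ⟨a, ?_⟩⟩
    -- Here `0 = a - 3a - 5a + 7a` is a sum, and the list below realizes `2a, 4a, …, 24a`: in all 1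
    -- + 2 · 12 = 25.
    · have h0 := signedSum_mem hab hbc hcd hde hsub (v := (1, -1, -1, 1, 0)) (by decide)
      have hz : signedSum a (3 * a) (5 * a) (7 * a) (9 * a) (1, -1, -1, 1, 0) = 0 := by
        simp only [signedSum]
        ring
      rw [hz] at h0
      have h := ncard_add_two_mul_length_le_of_subset (by omega) hpos hab hbc hcd hde hsub
        (Set.singleton_subset_iff.mpr h0) le_rfl (by simp)
        [(-1, 0, 1, 1, -1), (-1, 1, -1, 1, 0), (-1, 0, 1, -1, 1), (-1, -1, 1, 1, 0),
          (-1, -1, 1, 0, 1), (-1, -1, 0, 1, 1), (-1, 1, 1, 1, 0), (-1, 1, 1, 0, 1),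
          (-1, 1, 0, 1, 1), (-1, 0, 1, 1, 1), (1, 0, 1, 1, 1), (0, 1, 1, 1, 1)]
        (by decide) (by simp [signedSum]; omega)
      simpa using h
    · simp only [dilate_firstOdds_succ]
      simp [dilate, firstOdds]
      ring_nf

/-! ### Adjoining a new maximum -/

theorem insert_step {k : ℕ} (hk : 5 ≤ k) {A : Finset ℤ} (hA : A.card = k) {M : ℤ}
    (hM : ∀ a ∈ A, a < M) (hpos : ∀ a ∈ insert M A, 0 < a) :
    (restrictedSignedSumset 4 A).ncard + 8 ≤ (restrictedSignedSumset 4 (insert M A)).ncard := by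
  obtain ⟨n, rfl⟩ := Nat.exists_eq_add_of_le' (by omega : 4 ≤ k)
  obtain ⟨w, x, y, z, B, h, hB, hwx, hxy, hyz, hlt⟩ := exists_top_four hA
  have hz : z < M := hM z (by simp [h])
  have hposA : ∀ a ∈ A, 0 < a := fun a ha => hpos a (Finset.mem_insert_of_mem ha)
  have hw : 0 < w := hposA w (by simp [h])
  have hcard : 4 ≤ (insert M A).card :=
    (Finset.card_le_card (Finset.subset_insert M A)).trans' (by omega)
  refine ncard_add_two_mul_length_le_of_subset hcard hpos hwx hxy hyz hz ?_
    (restrictedSignedSumset_mono (Finset.subset_insert M A)) (by omega)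
    (fun t ht => abs_le_of_mem_restrictedSignedSumset h hwx hxy hyz hlt hposA ht)
    -- These omit `z`, `y`, `x`, `w` in turn. The smallest, `w + x + y + M`, beats the old bound
    -- because `z < M`.
    [(1, 1, 1, 0, 1), (1, 1, 0, 1, 1), (1, 0, 1, 1, 1), (0, 1, 1, 1, 1)] (by decide)
    (by simp [signedSum]; omega)
  intro t ht
  simp only [h, Finset.mem_insert, Finset.mem_singleton] at ht ⊢
  tauto

theorem eq_of_ncard_insert_dilate {k : ℕ} (hk : 5 ≤ k) {m M : ℤ}
    (hA : (dilate m (firstOdds k)).card = k) (hM : ∀ a ∈ dilate m (firstOdds k), a < M)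
    (hpos : ∀ a ∈ insert M (dilate m (firstOdds k)), 0 < a)
    (h : (restrictedSignedSumset 4 (insert M (dilate m (firstOdds k)))).ncard ≤
      (restrictedSignedSumset 4 (dilate m (firstOdds k))).ncard + 8) :
    M = m * (2 * k + 1) := by
  obtain ⟨n, rfl⟩ := Nat.exists_eq_add_of_le' hk
  set A := dilate m (firstOdds (n + 5)) with hAdef
  have hposA : ∀ a ∈ A, 0 < a := fun a ha => hpos a (Finset.mem_insert_of_mem ha)
  have hm : 0 < m := hposA m (by simpa using mul_mem_dilate_firstOdds m (Nat.succ_pos (n + 4)))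
  -- `p` is the fifth largest element of `A`. Keeping it opaque makes the comparisons linear in `p`,
  -- `m`, `M`.
  obtain ⟨p, hp⟩ : ∃ p, p = m * (2 * n + 1) := ⟨_, rfl⟩
  have hmn : 0 ≤ m * n := by positivity
  have hp0 : 0 < p := by rw [hp]; positivity
  have hA' : A = insert (p + 8 * m) (insert (p + 6 * m) (insert (p + 4 * m)
      (insert (p + 2 * m) (dilate m (firstOdds (n + 1)))))) := by
    simp only [hAdef, dilate_firstOdds_succ, hp]
    push_cast
    ring_nf
  have hmem0 : p ∈ A := by
    rw [hp]
    exact mul_mem_dilate_firstOdds m (by omega)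
  have hlt : ∀ b ∈ dilate m (firstOdds (n + 1)), b < p + 2 * m := by
    intro b hb
    simp only [dilate, firstOdds, Finset.mem_image, Finset.mem_range] at hb
    obtain ⟨_, ⟨i, hi, rfl⟩, rfl⟩ := hb
    rw [hp]
    have : (i : ℤ) ≤ n := by omega
    nlinarith
  have hMlt : p + 8 * m < M := hM _ (by simp [hA'])
  have hS : ∀ t ∈ restrictedSignedSumset 4 A, |t| ≤ 4 * p + 20 * m := fun t ht => by
    have := abs_le_of_mem_restrictedSignedSumset hA' (by omega) (by omega) (by omega) hlt hposA ht
    linarith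
  have hsub₀ : {p, p + 2 * m, p + 4 * m, p + 6 * m, M} ⊆ insert M A := by
    intro t ht
    simp only [Finset.mem_insert, Finset.mem_singleton] at ht
    rcases ht with ht | rfl | rfl | rfl | rfl
    · exact ht ▸ Finset.mem_insert_of_mem hmem0
    all_goals simp [hA']
  have hsub₁ : {p + 2 * m, p + 4 * m, p + 6 * m, p + 8 * m, M} ⊆ insert M A := by
    intro t ht
    simp only [Finset.mem_insert, Finset.mem_singleton] at ht
    rcases ht with rfl | rfl | rfl | rfl | rfl <;> simp [hA']
  have hmono := restrictedSignedSumset_mono (h := 4) (Finset.subset_insert M A)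
  have hcard : 4 ≤ (insert M A).card :=
    (Finset.card_le_card (Finset.subset_insert M A)).trans' (by omega)
  have hfin := finite_restrictedSignedSumset hcard hpos
  -- This sum is `2 * m` below `3 * p + 12 * m + M`, the smallest of the four sums used in
  -- `insert_step`.
  have ht₀ : 3 * p + 10 * m + M ∈ restrictedSignedSumset 4 (insert M A) := by
    convert signedSum_mem (by omega) (by omega) (by omega) (by omega) hsub₀
      (v := (1, 0, 1, 1, 1)) (by decide) using 1
    simp only [signedSum]
    ring
  have ht₀A : 3 * p + 10 * m + M ∈ restrictedSignedSumset 4 A := by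
    by_contra hn
    -- If not old, the sum either joins the bounded part (one more element) or starts the chain (two
    -- more, with its negative). Both exceed the permitted gain of 8.
    rcases le_or_gt (3 * p + 10 * m + M) (4 * p + 20 * m) with hle | hgt
    · have hcount := ncard_add_two_mul_length_le_of_subset hcard hpos (by omega) (by omega)
        (by omega) (by omega) hsub₁ (Set.insert_subset ht₀ hmono) (U := 4 * p + 20 * m) (by omega)
        (fun t ht => by
          rcases Set.mem_insert_iff.mp ht with rfl | ht
          · rw [abs_of_pos (by omega)]
            exact hle
          · exact hS t ht)
        [(1, 1, 1, 0, 1), (1, 1, 0, 1, 1), (1, 0, 1, 1, 1), (0, 1, 1, 1, 1)] (by decide)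
        (by simp [signedSum]; omega)
      rw [Set.ncard_insert_of_notMem hn (hfin.subset hmono)] at hcount
      simp only [List.length_cons, List.length_nil] at hcount
      omega
    · have hcount := ncard_add_two_mul_length_le hfin (fun _ => neg_mem_restrictedSignedSumset)
        hmono (by omega) hS ((3 * p + 10 * m + M) :: [(1, 1, 1, 0, 1), (1, 1, 0, 1, 1),
          (1, 0, 1, 1, 1), (0, 1, 1, 1, 1)].map
          (signedSum (p + 2 * m) (p + 4 * m) (p + 6 * m) (p + 8 * m) M))
        (fun t ht => by
          rcases List.mem_cons.mp ht with rfl | ht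
          · exact ht₀
          · obtain ⟨v, hv, rfl⟩ := List.mem_map.mp ht
            have hv' : ∀ v ∈ [((1, 1, 1, 0, 1) : ℤ × ℤ × ℤ × ℤ × ℤ), (1, 1, 0, 1, 1),
              (1, 0, 1, 1, 1), (0, 1, 1, 1, 1)], IsSignVector v := by decide
            exact signedSum_mem (by omega) (by omega) (by omega) (by omega) hsub₁ (hv' v hv))
        (by simp [signedSum]; omega)
      simp only [List.length_cons, List.length_map, List.length_nil] at hcount
      omega
  -- Being old bounds `M` by `p + 10 * m`, and divisibility makes `M` an odd multiple of `m`. As `M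
  -- > p + 8 * m`, only `p + 10 * m` remains.
  have hle := (abs_le.mp (hS _ ht₀A)).2
  obtain ⟨q, hq⟩ := dvd_of_mem_restrictedSignedSumset_dilate ht₀A
  have hMq : M = m * (2 * q - 6 * n - 13) := by
    rw [hp] at hq
    linarith
  rw [hp] at hle hMlt
  have h1 : 2 * q - 6 * n - 13 ≤ 2 * (n : ℤ) + 11 :=
    le_of_mul_le_mul_left (by linarith) hm
  have h2 : 2 * (n : ℤ) + 9 < 2 * q - 6 * n - 13 :=
    lt_of_mul_lt_mul_left (by linarith) hm.le
  rw [hMq]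
  push_cast
  congr 1
  omega

/-! ### Induction and conclusion -/

theorem ncard_bound_and_eq {k : ℕ} (hk : 5 ≤ k) : ∀ A : Finset ℤ, A.card = k →
    (∀ a ∈ A, 0 < a) → 8 * k ≤ (restrictedSignedSumset 4 A).ncard + 15 ∧
      ((restrictedSignedSumset 4 A).ncard + 15 = 8 * k → ∃ m, A = dilate m (firstOdds k)) := by
  induction k, hk using Nat.le_induction with
  | base =>
    intro A hA hpos
    obtain ⟨h1, h2⟩ := five_base hA hpos
    exact ⟨by omega, fun h => h2 (by omega)⟩
  | succ k hk ih =>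
    intro A hA hpos
    obtain ⟨M, B, rfl, hB, hM⟩ := exists_eq_insert_of_card hA
    have hposB : ∀ a ∈ B, 0 < a := fun a ha => hpos a (Finset.mem_insert_of_mem ha)
    obtain ⟨h1, h2⟩ := ih B hB hposB
    have h3 := insert_step hk hB hM hpos
    refine ⟨by omega, fun h => ?_⟩
    obtain ⟨m, rfl⟩ := h2 (by omega)
    refine ⟨m, ?_⟩
    rw [dilate_firstOdds_succ, ← eq_of_ncard_insert_dilate hk hB hM hpos (by omega)]

theorem min'_dilate_firstOdds {m : ℤ} {k : ℕ} (hk : 0 < k)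
    (hpos : ∀ a ∈ dilate m (firstOdds k), 0 < a) (hne : (dilate m (firstOdds k)).Nonempty) :
    (dilate m (firstOdds k)).min' hne = m := by
  have hm : m ∈ dilate m (firstOdds k) := by simpa using mul_mem_dilate_firstOdds m hk
  refine le_antisymm (Finset.min'_le _ _ hm) (Finset.le_min' _ _ _ fun a ha => ?_)
  have hm0 := hpos m hm
  simp only [dilate, firstOdds, Finset.mem_image, Finset.mem_range] at ha
  obtain ⟨_, ⟨i, -, rfl⟩, rfl⟩ := ha
  exact le_mul_of_one_le_right hm0.le (by omega)

theorem theorem3p1 (k : ℕ) (hk : 5 ≤ k) (A : Finset ℤ) (hcard : A.card = k)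
    (hpos : ∀ a ∈ A, 0 < a) :
    (8 * (k : ℤ) - 15 ≤ ((restrictedSignedSumset 4 A).ncard : ℤ)) ∧
    (((restrictedSignedSumset 4 A).ncard : ℤ) = 8 * (k : ℤ) - 15 →
      A = dilate (A.min' (Finset.card_pos.mp (by omega))) (firstOdds k)) := by
  obtain ⟨h1, h2⟩ := ncard_bound_and_eq hk A hcard hpos
  refine ⟨by omega, fun h => ?_⟩
  obtain ⟨m, rfl⟩ := h2 (by omega)
  rw [min'_dilate_firstOdds (by omega) hpos]
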